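/- Let $N\ge 2$, let $K$ be a complex Hilbert space and let $V_0,\dots,V_{N-1}$ be Cuntz isometries on $K$, i.e. $V_i^*V_j=\delta_{ij}I$ and $\sum_{i=0}^{N-1}V_iV_i^*=I$. Let $\mathcal T$ be a complete metric space and $e:\mathcal T\to K$, $t\mapsto e_t$, a continuous map with $\|e_t\|=1$ for all $t$ and such that the closed linear span of $\{e_t:t\in\mathcal T\}$ is $K$. Suppose that for every $i$ and $t$ we have $V_i^*e_t=\nu_i(t)e_{g_i(t)}$, where $\nu_i:\mathcal T\to\mathbb C$ and $g_i:\mathcal T\to\mathcal T$ are maps and each $g_i$ is a contraction (Lipschitz with a constant $<1$). A set $M\subseteq\mathcal T$ is invariant if $g_i(t)\in M$ whenever $t\in M$ and $\nu_i(t)\ne0$. A minimal compact invariant set is a nonempty compact invariant set that contains no other nonempty compact invariant set. Suppose that $\{V_i\}$ is reversing on these sets: for every minimal compact invariant set $M$, every $t\in M$ and every $i$ with $\nu_i(t)\neq0$, $V_ie_{g_i(t)}=\overline{\nu_i(t)}\,e_t$. For a finite word $\omega=\omega_1\cdots\omega_n$ with digits in $\{0,\dots,N-1\}$ (possibly the empty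 word) put $V_\omega=V_{\omega_1}\cdots V_{\omega_n}$, $g_\omega=g_{\omega_n}\circ\cdots\circ g_{\omega_1}$ and $\nu_\omega(t)=\nu_{\omega_1}(t)\,\nu_{\omega_2}(g_{\omega_1}(t))\cdots\nu_{\omega_n}(g_{\omega_1\cdots\omega_{n-1}}(t))$. A nonempty word $\beta$ is a cycle word for $c$ if $g_\beta(c)=c$, $\nu_\beta(c)\ne0$, and $g_\gamma(c)\neq c$ for every nonempty proper prefix $\gamma$ of $\beta$. Let $\Omega_c^{(0)}$ be the set of words that do not end in a cycle word for $c$. Then there are only finitely many minimal compact invariant sets $M_1,\dots,M_p$, and: 1. for every $i=1,\dots,p$, every $c\in M_i$ and every $j\in\{0,\dots,N-1\}$, $|\nu_j(c)|$ is $0$ or $1$; 2. for every choice of points $c_i\in M_i$, $i=1,\dots,p$, the family $(V_\omega e_{c_i})_{1\le i\le p,\ \omega\in\Omega_{c_i}^{(0)}}$ is an orthonormal basis of $K$. -/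

import Mathlib

namespace CuntzWalk

/-- `(V i)` are Cuntz isometries: `V i* V j = δ i j` and `∑ V i V i* = 1`. -/
def IsCuntz {K : Type*} [NormedAddCommGroup K] [InnerProductSpace ℂ K] [CompleteSpace K]
    {N : ℕ} (V : Fin N → K →L[ℂ] K) : Prop :=
  (∀ i j, ContinuousLinearMap.adjoint (V i) * V j = if i = j then 1 else 0) ∧
    ∑ i, V i * ContinuousLinearMap.adjoint (V i) = 1

/-- The operator `V_ω = V_{ω₁} ⋯ V_{ωₙ}` of a word `ω = ω₁…ωₙ`. -/
def wordOp {K : Type*} [NormedAddCommGroup K] [InnerProductSpace ℂ K]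
    {N : ℕ} (V : Fin N → K →L[ℂ] K) (ω : List (Fin N)) : K →L[ℂ] K :=
  (ω.map V).prod

/-- The point `g_ω(t) = g_{ωₙ}(⋯ g_{ω₁}(t) ⋯)`; the first digit acts first. -/
def wordMap {T : Type*} {N : ℕ} (g : Fin N → T → T) : List (Fin N) → T → T
  | [], t => t
  | i :: ω, t => wordMap g ω (g i t)

/-- The weight `ν_ω(t) = ν_{ω₁}(t) ν_{ω₂}(g_{ω₁}(t)) ⋯ ν_{ωₙ}(g_{ω₁…ωₙ₋₁}(t))`. -/
def wordWeight {T : Type*} {N : ℕ} (g : Fin N → T → T) (ν : Fin N → T → ℂ) :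
    List (Fin N) → T → ℂ
  | [], _ => 1
  | i :: ω, t => ν i t * wordWeight g ν ω (g i t)

/-- `M` is invariant: it contains `g i t` whenever `t ∈ M` and the transition `t → g i t` is
possible, that is, `ν i t ≠ 0`. -/
def IsInvariant {T : Type*} {N : ℕ} (g : Fin N → T → T) (ν : Fin N → T → ℂ)
    (M : Set T) : Prop :=
  ∀ t ∈ M, ∀ i, ν i t ≠ 0 → g i t ∈ M

/-- Minimal compact invariant sets: the minimal elements, under inclusion, among the nonempty
compact invariant sets. -/
def IsMinimalSet {T : Type*} [TopologicalSpace T] {N : ℕ} (g : Fin N → T → T)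
    (ν : Fin N → T → ℂ) (M : Set T) : Prop :=
  M.Nonempty ∧ IsCompact M ∧ IsInvariant g ν M ∧
    ∀ M' : Set T, M' ⊆ M → M'.Nonempty → IsCompact M' → IsInvariant g ν M' → M' = M

/-- `(V i)` is reversing on the part of the random walk that lives on `M`. -/
def IsReversingOn {K : Type*} [NormedAddCommGroup K] [InnerProductSpace ℂ K] {T : Type*}
    {N : ℕ} (V : Fin N → K →L[ℂ] K) (e : T → K) (g : Fin N → T → T) (ν : Fin N → T → ℂ)
    (M : Set T) : Prop :=
  ∀ t ∈ M, ∀ i, ν i t ≠ 0 → V i (e (g i t)) = (starRingEnd ℂ) (ν i t) • e t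

/-- `β` is a cycle word for `c`: it is nonempty, it leads from `c` back to `c` with nonzero
weight, and no nonempty proper prefix of it leads to `c`. -/
def IsCycleWord {T : Type*} {N : ℕ} (g : Fin N → T → T) (ν : Fin N → T → ℂ) (c : T)
    (β : List (Fin N)) : Prop :=
  β ≠ [] ∧ wordMap g β c = c ∧ wordWeight g ν β c ≠ 0 ∧
    ∀ γ : List (Fin N), γ <+: β → γ ≠ [] → γ ≠ β → wordMap g γ c ≠ c

/-- The set `Ω_c⁽⁰⁾` of the words that do not end in a cycle word for `c`. -/
def noCycleEnd {T : Type*} {N : ℕ} (g : Fin N → T → T) (ν : Fin N → T → ℂ) (c : T) :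
    Set (List (Fin N)) :=
  {ω | ¬ ∃ β : List (Fin N), IsCycleWord g ν c β ∧ β <:+ ω}

end CuntzWalk

/-! Since `V i` is isometric, reversibility forces nonzero weights on a minimal set to have modulus
1. As `∑ i, ‖ν i t‖ ^ 2 = 1`, exactly one transition leaves each such point, and the walk there is
given by a map `F`. If `e t` and `e s` are not orthogonal, some term of `∑ i, ⟪V i* e t, V i* e s⟫ =
⟪e t, e s⟫` is nonzero. Both points then use the same digit, `F` contracts their distance, and their
images are again nonorthogonal. With compactness this makes every minimal set a finite cycle and
distinct cycle points orthogonal (`exists_step`). All cycle points lie in one compact orbit closure,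
where `e` cannot take infinitely many pairwise orthogonal values, so there are finitely many cycles.

Two basis vectors can be nonorthogonal only if one word extends the other by a loop at `c`, and such
a loop ends in a cycle word. For completeness, reversibility absorbs cycle words, so the span of the
family reduces every `V i` and contains `e` on all minimal sets. For the projection `P` onto its
orthogonal complement, `‖P e t‖ ^ 2` is harmonic for the walk. The maximum principle yields a
minimal set where it is maximal, hence it vanishes (`eq_bot_of_reducing`). -/

namespace CuntzWalk

/-! ### Words and loops. -/

section Words

variable {T : Type*} {N : ℕ} {g : Fin N → T → T} {ν : Fin N → T → ℂ}

lemma wordMap_append (ω τ : List (Fin N)) (t : T) :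
    wordMap g (ω ++ τ) t = wordMap g τ (wordMap g ω t) := by
  induction ω generalizing t with
  | nil => rfl
  | cons i ω ih => exact ih (g i t)

lemma wordWeight_append (ω τ : List (Fin N)) (t : T) :
    wordWeight g ν (ω ++ τ) t = wordWeight g ν ω t * wordWeight g ν τ (wordMap g ω t) := by
  induction ω generalizing t with
  | nil => simp [wordWeight, wordMap]
  | cons i ω ih => simp [wordWeight, wordMap, ih, mul_assoc]

lemma IsInvariant.wordMap_mem {M : Set T} (hM : IsInvariant g ν M) {ω : List (Fin N)} {t : T}
    (ht : t ∈ M) (h : wordWeight g ν ω t ≠ 0) : wordMap g ω t ∈ M := by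
  induction ω generalizing t with
  | nil => exact ht
  | cons i ω ih =>
    have h' := mul_ne_zero_iff.1 h
    exact ih (hM t ht i h'.1) h'.2

/-- A loop at `c` of nonzero weight ends in a cycle word for `c`. -/
lemma exists_isCycleWord_suffix {c : T} (α : List (Fin N)) (hα : α ≠ [])
    (hmap : wordMap g α c = c) (hw : wordWeight g ν α c ≠ 0) :
    ∃ β, IsCycleWord g ν c β ∧ β <:+ α := by
  by_cases h : ∀ γ : List (Fin N), γ <+: α → γ ≠ [] → γ ≠ α → wordMap g γ c ≠ c
  · exact ⟨α, ⟨hα, hmap, hw, h⟩, List.suffix_rfl⟩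
  · push Not at h
    obtain ⟨γ, ⟨δ, rfl⟩, hγ, hne, hc⟩ := h
    have hδ : δ ≠ [] := by rintro rfl; simp at hne
    -- Once the prefix `γ` has returned to `c`, the rest `δ` is a shorter loop at `c`.
    rw [wordMap_append, hc] at hmap
    rw [wordWeight_append, hc] at hw
    have hlen : δ.length < (γ ++ δ).length := by
      simpa using List.length_pos_of_ne_nil hγ
    obtain ⟨β, hβ, hs⟩ := exists_isCycleWord_suffix δ hδ hmap (mul_ne_zero_iff.1 hw).2
    exact ⟨β, hβ, hs.trans (List.suffix_append _ _)⟩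
termination_by α.length

lemma exists_word_iterate {a : T → Fin N} (ha : ∀ t, ν (a t) t ≠ 0) (n : ℕ) (t : T) :
    ∃ ω : List (Fin N), ω.length = n ∧ wordMap g ω t = (fun t => g (a t) t)^[n] t ∧
      wordWeight g ν ω t ≠ 0 := by
  induction n generalizing t with
  | zero => exact ⟨[], rfl, rfl, one_ne_zero⟩
  | succ n ih =>
    obtain ⟨ω, h1, h2, h3⟩ := ih (g (a t) t)
    exact ⟨a t :: ω, by simp [h1], h2, mul_ne_zero (ha t) h3⟩

lemma lipschitzWith_wordMap {T : Type*} [MetricSpace T] {g : Fin N → T → T} {k : NNReal}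
    (hg : ∀ i, LipschitzWith k (g i)) (ω : List (Fin N)) :
    LipschitzWith (k ^ ω.length) (wordMap g ω) := by
  induction ω with
  | nil =>
    rw [List.length_nil, pow_zero]
    exact LipschitzWith.id
  | cons i ω ih =>
    rw [List.length_cons, pow_succ]
    exact ih.comp (hg i)

end Words

/-! ### Compactness of orbit closures. -/

section Attractor

variable {T : Type*} [MetricSpace T] {N : ℕ} {g : Fin N → T → T} {k : NNReal}

lemma dist_wordMap_le (hk : k < 1) (hg : ∀ i, LipschitzWith k (g i)) (x : T) :
    ∃ R : ℝ, ∀ ω : List (Fin N), dist (wordMap g ω x) x ≤ R := by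
  have hk' : (k : ℝ) < 1 := hk
  set D : ℝ := ∑ i, dist (g i x) x with hD
  have hDi : ∀ i, dist (g i x) x ≤ D := fun i =>
    Finset.single_le_sum (f := fun i => dist (g i x) x) (fun _ _ => dist_nonneg)
      (Finset.mem_univ i)
  have hD0 : 0 ≤ D := Finset.sum_nonneg fun _ _ => dist_nonneg
  -- This radius is the fixed point of `r ↦ k * r + D`, the bound after one more digit.
  refine ⟨D / (1 - k), fun ω => ?_⟩
  induction ω using List.reverseRecOn with
  | nil => simpa [wordMap] using div_nonneg hD0 (by linarith)
  | append_singleton ω i ih =>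
    rw [wordMap_append]
    calc dist (g i (wordMap g ω x)) x
        ≤ dist (g i (wordMap g ω x)) (g i x) + dist (g i x) x := dist_triangle _ _ _
      _ ≤ k * (D / (1 - k)) + D := by
          gcongr
          · exact ((hg i).dist_le_mul _ _).trans (by gcongr)
          · exact hDi i
      _ = D / (1 - k) := by
          have : (1 - k : ℝ) ≠ 0 := by linarith
          field_simp
          ring

/-- The orbit of a point under finitely many contractions is totally bounded. -/
lemma totallyBounded_orbit (hk : k < 1) (hg : ∀ i, LipschitzWith k (g i)) (x : T) :
    TotallyBounded (Set.range fun ω : List (Fin N) => wordMap g ω x) := by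
  obtain ⟨R, hR⟩ := dist_wordMap_le hk hg x
  refine Metric.totallyBounded_iff.2 fun ε hε => ?_
  have hlim : Filter.Tendsto (fun n => (k : ℝ) ^ n * R) Filter.atTop (nhds 0) := by
    simpa using (tendsto_pow_atTop_nhds_zero_of_lt_one k.2 hk).mul_const R
  obtain ⟨n, hn⟩ := (hlim.eventually (gt_mem_nhds hε)).exists
  -- The last `n` digits determine the image up to `k ^ n * R < ε`, so words of length at most `n`
  -- give a finite net.
  refine ⟨(fun ω : List (Fin N) => wordMap g ω x) '' {ω | ω.length ≤ n},
    (List.finite_length_le (Fin N) n).image _, ?_⟩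
  rintro _ ⟨ω, rfl⟩
  simp only [Set.mem_iUnion, Metric.mem_ball]
  by_cases h : ω.length ≤ n
  · exact ⟨_, ⟨ω, h, rfl⟩, by simpa using hε⟩
  · refine ⟨_, ⟨ω.drop (ω.length - n), by simp; omega, rfl⟩, ?_⟩
    have hsplit : wordMap g ω x = wordMap g (ω.drop (ω.length - n))
        (wordMap g (ω.take (ω.length - n)) x) := by
      rw [← wordMap_append, List.take_append_drop]
    have hlen : (ω.drop (ω.length - n)).length = n := by simp; omega
    change dist (wordMap g ω x) _ < ε
    rw [hsplit]
    refine lt_of_le_of_lt ((lipschitzWith_wordMap hg _).dist_le_mul _ _) ?_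
    rw [hlen]
    push_cast
    exact lt_of_le_of_lt (by gcongr; exact hR _) hn

/-- The closure of the orbit of a point is compact. -/
lemma isCompact_closure_orbit [CompleteSpace T] (hk : k < 1) (hg : ∀ i, LipschitzWith k (g i))
    (x : T) : IsCompact (closure (Set.range fun ω : List (Fin N) => wordMap g ω x)) :=
  isCompact_iff_totallyBounded_isComplete.2
    ⟨(totallyBounded_orbit hk hg x).closure, isClosed_closure.isComplete⟩

lemma mapsTo_closure_orbit (hg : ∀ i, LipschitzWith k (g i)) (x : T) (i : Fin N) :
    Set.MapsTo (g i) (closure (Set.range fun ω : List (Fin N) => wordMap g ω x))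
      (closure (Set.range fun ω : List (Fin N) => wordMap g ω x)) := by
  refine Set.MapsTo.closure ?_ (hg i).continuous
  rintro _ ⟨ω, rfl⟩
  exact ⟨ω ++ [i], by simp [wordMap_append, wordMap]⟩

/-- A point that words of unbounded length fix lies in the closure of every orbit. -/
lemma mem_closure_orbit (hk : k < 1) (hg : ∀ i, LipschitzWith k (g i)) (x t : T)
    (ht : ∀ n, ∃ ω : List (Fin N), n ≤ ω.length ∧ wordMap g ω t = t) :
    t ∈ closure (Set.range fun ω : List (Fin N) => wordMap g ω x) := by
  refine Metric.mem_closure_iff.2 fun ε hε => ?_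
  have hlim : Filter.Tendsto (fun n => (k : ℝ) ^ n * dist t x) Filter.atTop (nhds 0) := by
    simpa using (tendsto_pow_atTop_nhds_zero_of_lt_one k.2 hk).mul_const (dist t x)
  obtain ⟨n, hn⟩ := (hlim.eventually (gt_mem_nhds hε)).exists
  obtain ⟨ω, hω, hωt⟩ := ht n
  refine ⟨_, ⟨ω, rfl⟩, ?_⟩
  calc dist t (wordMap g ω x) = dist (wordMap g ω t) (wordMap g ω x) := by rw [hωt]
    _ ≤ (k ^ ω.length : NNReal) * dist t x := (lipschitzWith_wordMap hg ω).dist_le_mul _ _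
    _ ≤ (k : ℝ) ^ n * dist t x := by
        push_cast
        exact mul_le_mul_of_nonneg_right (pow_le_pow_of_le_one k.2 hk.le hω) dist_nonneg
    _ < ε := hn

end Attractor

/-! ### Existence of minimal sets. -/

section Minimal

variable {T : Type*} [TopologicalSpace T] [T2Space T] {N : ℕ} {g : Fin N → T → T}
  {ν : Fin N → T → ℂ}

/-- Every nonempty compact invariant set contains a minimal one. -/
lemma exists_isMinimalSet_subset {A : Set T} (hne : A.Nonempty) (hA : IsCompact A)
    (hinv : IsInvariant g ν A) : ∃ M ⊆ A, IsMinimalSet g ν M := by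
  let S : Set (Set T) := {M | M.Nonempty ∧ IsCompact M ∧ IsInvariant g ν M}
  obtain ⟨M, hMA, hM⟩ := zorn_superset_nonempty S (by
    intro C hCS hC hCne
    have hCne' : Nonempty C := hCne.to_subtype
    refine ⟨⋂₀ C, ⟨?_, ?_, ?_⟩, fun s hs => Set.sInter_subset_of_mem hs⟩
    · exact IsCompact.nonempty_sInter_of_directed_nonempty_isCompact_isClosed
        (fun s hs t ht => (hC.total hs ht).elim (fun h => ⟨s, hs, subset_rfl, h⟩)
          fun h => ⟨t, ht, h, subset_rfl⟩)
        (fun s hs => (hCS hs).1) (fun s hs => (hCS hs).2.1) (fun s hs => (hCS hs).2.1.isClosed)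
    · obtain ⟨s, hs⟩ := hCne
      exact (hCS hs).2.1.of_isClosed_subset
        (isClosed_sInter fun s hs => (hCS hs).2.1.isClosed) (Set.sInter_subset_of_mem hs)
    · exact fun t ht i hi s hs => (hCS hs).2.2 t (ht s hs) i hi) A ⟨hne, hA, hinv⟩
  exact ⟨M, hMA, hM.1.1, hM.1.2.1, hM.1.2.2, fun M' hsub h1 h2 h3 =>
    hsub.antisymm (hM.2 ⟨h1, h2, h3⟩ hsub)⟩

end Minimal

/-! ### Maps that contract nonorthogonal pairs. -/

section Deterministic

variable {K : Type*} [NormedAddCommGroup K] [InnerProductSpace ℂ K]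
  {T : Type*} [MetricSpace T] {e : T → K}

local notation "⟪" x ", " y "⟫" => inner ℂ x y

lemma inner_ne_zero_of_norm_sub_lt_one {x y : K} (hx : ‖x‖ = 1) (h : ‖x - y‖ < 1) :
    ⟪x, y⟫ ≠ 0 := by
  intro h0
  have h1 : ⟪x, x - y⟫ = 1 := by
    rw [inner_sub_right, h0, inner_self_eq_norm_sq_to_K, hx]; simp
  have h2 := norm_inner_le_norm (𝕜 := ℂ) x (x - y)
  rw [h1, hx] at h2
  simp at h2
  linarith

variable {F : T → T} {U : Set T} {k : NNReal}

lemma inner_iterate_ne_zero (hFU : Set.MapsTo F U U)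
    (hF : ∀ t ∈ U, ∀ s ∈ U, ⟪e t, e s⟫ ≠ 0 →
      ⟪e (F t), e (F s)⟫ ≠ 0 ∧ dist (F t) (F s) ≤ k * dist t s)
    {t s : T} (ht : t ∈ U) (hs : s ∈ U) (hts : ⟪e t, e s⟫ ≠ 0) (n : ℕ) :
    ⟪e (F^[n] t), e (F^[n] s)⟫ ≠ 0 ∧ dist (F^[n] t) (F^[n] s) ≤ (k : ℝ) ^ n * dist t s := by
  induction n with
  | zero => simpa using hts
  | succ n ih =>
    rw [Function.iterate_succ_apply', Function.iterate_succ_apply']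
    obtain ⟨h1, h2⟩ := hF _ (hFU.iterate n ht) _ (hFU.iterate n hs) ih.1
    refine ⟨h1, h2.trans ?_⟩
    rw [pow_succ', mul_assoc]
    gcongr
    exact ih.2

/-- After `p * q` steps both points are back, yet their distance has shrunk by the factor `k ^ (p *
q) < 1`. -/
lemma eq_of_inner_ne_zero (hk : k < 1) (hFU : Set.MapsTo F U U)
    (hF : ∀ t ∈ U, ∀ s ∈ U, ⟪e t, e s⟫ ≠ 0 →
      ⟪e (F t), e (F s)⟫ ≠ 0 ∧ dist (F t) (F s) ≤ k * dist t s)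
    {t s : T} (ht : t ∈ U) (hs : s ∈ U) (hts : ⟪e t, e s⟫ ≠ 0) {p q : ℕ}
    (hp : 0 < p) (hq : 0 < q) (hpt : Function.IsPeriodicPt F p t)
    (hqs : Function.IsPeriodicPt F q s) : t = s := by
  have h := (inner_iterate_ne_zero hFU hF ht hs hts (p * q)).2
  rw [(hpt.mul_const q).eq, (hqs.const_mul p).eq] at h
  have hlt : (k : ℝ) ^ (p * q) < 1 := pow_lt_one₀ k.2 hk (Nat.mul_pos hp hq).ne'
  refine dist_eq_zero.1 (le_antisymm ?_ dist_nonneg)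
  nlinarith [dist_nonneg (x := t) (y := s)]

/-- Two terms of a sequence in a compact set have nonorthogonal images. -/
lemma exists_lt_inner_ne_zero (he : Continuous e) (he1 : ∀ t, ‖e t‖ = 1) {M : Set T}
    (hM : IsCompact M) (x : ℕ → T) (hx : ∀ n, x n ∈ M) :
    ∃ m n, m < n ∧ ⟪e (x m), e (x n)⟫ ≠ 0 := by
  obtain ⟨z, -, φ, hφ, hlim⟩ := hM.tendsto_subseq hx
  have hc : CauchySeq (fun n => e (x (φ n))) := ((he.tendsto z).comp hlim).cauchySeq
  obtain ⟨n, hn⟩ := Metric.cauchySeq_iff.1 hc 1 one_pos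
  refine ⟨φ n, φ (n + 1), hφ n.lt_succ_self, inner_ne_zero_of_norm_sub_lt_one (he1 _) ?_⟩
  simpa [dist_eq_norm] using hn n le_rfl (n + 1) n.le_succ

/-- Compactness gives nonorthogonal iterates `y` and `F^[q] y`. Contraction then makes `F^[j * q] y`
Cauchy, and its limit is fixed by `F^[q]`. -/
lemma exists_isPeriodicPt (he : Continuous e) (he1 : ∀ t, ‖e t‖ = 1) (hk : k < 1)
    {M : Set T} (hM : IsCompact M) (hne : M.Nonempty) (hFM : Set.MapsTo F M M)
    (hF : ∀ t ∈ M, ∀ s ∈ M, ⟪e t, e s⟫ ≠ 0 →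
      ⟪e (F t), e (F s)⟫ ≠ 0 ∧ dist (F t) (F s) ≤ k * dist t s) :
    ∃ z ∈ M, ∃ p, 0 < p ∧ Function.IsPeriodicPt F p z := by
  obtain ⟨t, ht⟩ := hne
  obtain ⟨m, n, hmn, hR⟩ := exists_lt_inner_ne_zero he he1 hM (fun n => F^[n] t)
    fun n => hFM.iterate n ht
  obtain ⟨p, rfl⟩ := Nat.exists_eq_add_of_lt hmn
  set q := p + 1 with hq
  set y := F^[m] t with hy
  have hyM : y ∈ M := hFM.iterate m ht
  have hR' : ⟪e y, e (F^[q] y)⟫ ≠ 0 := by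
    rw [hy, ← Function.iterate_add_apply]
    convert hR using 4
    omega
  have hkq : (k : ℝ) ^ q < 1 := pow_lt_one₀ k.2 hk (by omega)
  have hcauchy : CauchySeq (fun j => F^[j * q] y) := by
    refine cauchySeq_of_le_geometric ((k : ℝ) ^ q) (dist y (F^[q] y)) hkq fun j => ?_
    have := (inner_iterate_ne_zero hFM hF hyM (hFM.iterate q hyM) hR' (j * q)).2
    rw [← Function.iterate_add_apply F (j * q) q y] at this
    rw [add_mul, one_mul, ← pow_mul, mul_comm q j, mul_comm (dist _ _)]
    exact this
  obtain ⟨z, hzM, hz⟩ := cauchySeq_tendsto_of_isComplete hM.isComplete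
    (fun j => hFM.iterate (j * q) hyM) hcauchy
  refine ⟨z, hzM, q, by omega, ?_⟩
  have hclose : ∀ᶠ j in Filter.atTop, ‖e (F^[j * q] y) - e z‖ < 1 := by
    have := ((he.tendsto z).comp hz).eventually (Metric.ball_mem_nhds _ one_pos)
    simpa [dist_eq_norm] using this
  have h1 : Filter.Tendsto (fun j => F^[(j + 1) * q] y) Filter.atTop (nhds z) :=
    hz.comp (Filter.tendsto_add_atTop_nat 1)
  -- Continuity of `F` is not assumed. Near `z` the vectors are not orthogonal to `e z`, so the
  -- contraction estimate applies to pairs with `z`.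
  have h2 : Filter.Tendsto (fun j => F^[(j + 1) * q] y) Filter.atTop (nhds (F^[q] z)) := by
    refine tendsto_iff_dist_tendsto_zero.2 (squeeze_zero' (.of_forall fun _ => dist_nonneg)
      (hclose.mono fun j hj => ?_) (g := fun j => (k : ℝ) ^ q * dist (F^[j * q] y) z) ?_)
    · have := (inner_iterate_ne_zero hFM hF (hFM.iterate (j * q) hyM) hzM
        (inner_ne_zero_of_norm_sub_lt_one (he1 _) hj) q).2
      rw [← Function.iterate_add_apply] at this
      rwa [add_mul, one_mul, add_comm]
    · simpa using (tendsto_iff_dist_tendsto_zero.1 hz).const_mul ((k : ℝ) ^ q)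
  exact tendsto_nhds_unique h2 h1

end Deterministic

/-! ### Cuntz relations and reversing walks. -/

section Operators

open ContinuousLinearMap (adjoint)

variable {K : Type*} [NormedAddCommGroup K] [InnerProductSpace ℂ K]

local notation "⟪" x ", " y "⟫" => inner ℂ x y

variable {N : ℕ} {V : Fin N → K →L[ℂ] K}

lemma wordOp_append (ω τ : List (Fin N)) (x : K) :
    wordOp V (ω ++ τ) x = wordOp V ω (wordOp V τ x) := by
  simp [wordOp]

lemma wordOp_cons (i : Fin N) (ω : List (Fin N)) (x : K) :
    wordOp V (i :: ω) x = V i (wordOp V ω x) := by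
  simp [wordOp]

variable [CompleteSpace K]

lemma IsCuntz.adjoint_apply (hV : IsCuntz V) (i j : Fin N) (x : K) :
    adjoint (V i) (V j x) = if i = j then x else 0 := by
  have := congrArg (fun A : K →L[ℂ] K => A x) (hV.1 i j)
  split_ifs with h <;> simpa [h] using this

lemma IsCuntz.inner_apply (hV : IsCuntz V) (i j : Fin N) (x y : K) :
    ⟪V i x, V j y⟫ = if i = j then ⟪x, y⟫ else 0 := by
  rw [← ContinuousLinearMap.adjoint_inner_right, hV.adjoint_apply]
  split_ifs <;> simp

lemma IsCuntz.sum_inner_adjoint (hV : IsCuntz V) (x y : K) :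
    ∑ i, ⟪adjoint (V i) x, adjoint (V i) y⟫ = ⟪x, y⟫ := by
  have := congrArg (fun A : K →L[ℂ] K => ⟪x, A y⟫) hV.2
  simpa [_root_.sum_apply, inner_sum, ContinuousLinearMap.adjoint_inner_left]
    using this

lemma IsCuntz.sum_norm_adjoint_sq (hV : IsCuntz V) (x : K) :
    ∑ i, ‖adjoint (V i) x‖ ^ 2 = ‖x‖ ^ 2 := by
  have h := hV.sum_inner_adjoint x x
  simp only [inner_self_eq_norm_sq_to_K] at h
  exact_mod_cast h

lemma IsCuntz.norm_apply (hV : IsCuntz V) (i : Fin N) (x : K) : ‖V i x‖ = ‖x‖ := by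
  have h := hV.inner_apply i i x x
  rw [if_pos rfl, inner_self_eq_norm_sq_to_K, inner_self_eq_norm_sq_to_K] at h
  have h' : ‖V i x‖ ^ 2 = ‖x‖ ^ 2 := by exact_mod_cast h
  exact (sq_eq_sq₀ (norm_nonneg _) (norm_nonneg _)).1 h'

lemma IsCuntz.norm_wordOp (hV : IsCuntz V) (ω : List (Fin N)) (x : K) :
    ‖wordOp V ω x‖ = ‖x‖ := by
  induction ω with
  | nil => simp [wordOp]
  | cons i ω ih => rw [wordOp_cons, hV.norm_apply, ih]

/-- Ranges of two words are orthogonal unless one word is a prefix of the other. -/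
lemma IsCuntz.prefix_of_inner_ne_zero (hV : IsCuntz V) (ω τ : List (Fin N)) (x y : K)
    (h : ⟪wordOp V ω x, wordOp V τ y⟫ ≠ 0) :
    (∃ α, τ = ω ++ α ∧ ⟪x, wordOp V α y⟫ ≠ 0) ∨ ∃ α, ω = τ ++ α ∧ ⟪wordOp V α x, y⟫ ≠ 0 := by
  induction ω generalizing τ with
  | nil => exact .inl ⟨τ, rfl, by simpa [wordOp] using h⟩
  | cons i ω ih =>
    cases τ with
    | nil => exact .inr ⟨i :: ω, rfl, by simpa [wordOp] using h⟩
    | cons j τ =>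
      rw [wordOp_cons, wordOp_cons, hV.inner_apply] at h
      split_ifs at h with hij
      · subst hij
        rcases ih τ h with ⟨α, rfl, hα⟩ | ⟨α, rfl, hα⟩
        · exact .inl ⟨α, rfl, hα⟩
        · exact .inr ⟨α, rfl, hα⟩
      · exact absurd rfl h

lemma starProjection_adjoint_apply {A : K →L[ℂ] K} {L : Submodule ℂ K}
    [L.HasOrthogonalProjection] (h1 : ∀ x ∈ L, A x ∈ L) (h2 : ∀ x ∈ L, adjoint A x ∈ L) (x : K) :
    L.starProjection (adjoint A x) = adjoint A (L.starProjection x) := by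
  refine Submodule.eq_starProjection_of_mem_orthogonal' (z := adjoint A (x - L.starProjection x))
    (h2 _ (L.starProjection_apply_mem x)) ?_ (by simp)
  refine (Submodule.mem_orthogonal _ _).2 fun u hu => ?_
  rw [ContinuousLinearMap.adjoint_inner_right]
  exact (Submodule.mem_orthogonal _ _).1 (L.sub_starProjection_mem_orthogonal x) _ (h1 u hu)

variable {T : Type*} {e : T → K} {g : Fin N → T → T} {ν : Fin N → T → ℂ}

lemma inner_wordOp (hVe : ∀ i t, adjoint (V i) (e t) = ν i t • e (g i t)) (ω : List (Fin N))
    (t : T) (y : K) :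
    ⟪e t, wordOp V ω y⟫ = starRingEnd ℂ (wordWeight g ν ω t) * ⟪e (wordMap g ω t), y⟫ := by
  induction ω generalizing t with
  | nil => simp [wordOp, wordWeight, wordMap]
  | cons i ω ih =>
    rw [wordOp_cons, ← ContinuousLinearMap.adjoint_inner_left, hVe, inner_smul_left, ih]
    simp [wordWeight, wordMap, mul_assoc]

lemma IsCuntz.sum_norm_weight_sq (hV : IsCuntz V)
    (hVe : ∀ i t, adjoint (V i) (e t) = ν i t • e (g i t)) (he1 : ∀ t, ‖e t‖ = 1) (t : T) :
    ∑ i, ‖ν i t‖ ^ 2 = 1 := by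
  simpa [hVe, norm_smul, he1] using hV.sum_norm_adjoint_sq (e t)

lemma IsCuntz.exists_weight_ne_zero (hV : IsCuntz V)
    (hVe : ∀ i t, adjoint (V i) (e t) = ν i t • e (g i t)) (he1 : ∀ t, ‖e t‖ = 1) (t : T) :
    ∃ i, ν i t ≠ 0 := by
  by_contra! h
  simpa [h] using hV.sum_norm_weight_sq hVe he1 t

lemma IsReversingOn.norm_weight (hV : IsCuntz V) (he1 : ∀ t, ‖e t‖ = 1) {M : Set T}
    (hM : IsReversingOn V e g ν M) {t : T} (ht : t ∈ M) {i : Fin N} (hi : ν i t ≠ 0) :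
    ‖ν i t‖ = 1 := by
  have h := congrArg norm (hM t ht i hi)
  rw [hV.norm_apply, norm_smul, he1, he1] at h
  simpa using h.symm

/-- Two nonzero weights, each of modulus 1, would push the sum of squares to at least 2. -/
lemma IsReversingOn.eq_of_weight_ne_zero (hV : IsCuntz V)
    (hVe : ∀ i t, adjoint (V i) (e t) = ν i t • e (g i t)) (he1 : ∀ t, ‖e t‖ = 1) {M : Set T}
    (hM : IsReversingOn V e g ν M) {t : T} (ht : t ∈ M) {i j : Fin N} (hi : ν i t ≠ 0)
    (hj : ν j t ≠ 0) : i = j := by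
  by_contra hij
  have h : ∑ l ∈ {i, j}, ‖ν l t‖ ^ 2 ≤ ∑ l, ‖ν l t‖ ^ 2 :=
    Finset.sum_le_univ_sum_of_nonneg fun _ => by positivity
  rw [Finset.sum_pair hij, hV.sum_norm_weight_sq hVe he1, hM.norm_weight hV he1 ht hi,
    hM.norm_weight hV he1 ht hj] at h
  norm_num at h

omit [CompleteSpace K] in
-- For a loop this shows that the word acts on `e t` as a scalar, which is how cycle words are
-- removed.
lemma IsReversingOn.wordOp_apply {M : Set T} (hM : IsReversingOn V e g ν M)
    (hinv : IsInvariant g ν M) {t : T} (ht : t ∈ M) {ω : List (Fin N)}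
    (hω : wordWeight g ν ω t ≠ 0) :
    wordOp V ω (e (wordMap g ω t)) = starRingEnd ℂ (wordWeight g ν ω t) • e t := by
  induction ω generalizing t with
  | nil => simp [wordOp, wordMap, wordWeight]
  | cons i ω ih =>
    have h := mul_ne_zero_iff.1 hω
    rw [wordOp_cons, wordMap, ih (hinv t ht i h.1) h.2, map_smul, hM t ht i h.1, smul_smul,
      wordWeight, map_mul, mul_comm]

/-- The step of a walk that is deterministic at `t` and at `s`. -/
lemma IsCuntz.inner_step (hV : IsCuntz V)
    (hVe : ∀ i t, adjoint (V i) (e t) = ν i t • e (g i t)) {t s : T} {i j : Fin N}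
    (ht : ∀ l, ν l t ≠ 0 → l = i) (hs : ∀ l, ν l s ≠ 0 → l = j) (h : ⟪e t, e s⟫ ≠ 0) :
    i = j ∧ ⟪e (g i t), e (g j s)⟫ ≠ 0 := by
  rw [← hV.sum_inner_adjoint] at h
  obtain ⟨l, -, hl⟩ := Finset.exists_ne_zero_of_sum_ne_zero h
  rw [hVe, hVe, inner_smul_left, inner_smul_right] at hl
  simp only [ne_eq, mul_eq_zero, map_eq_zero, not_or] at hl
  obtain rfl := ht l hl.1
  obtain rfl := hs l hl.2.1
  exact ⟨rfl, hl.2.2⟩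

/-! ### Maximum principle and cycle structure. -/

section Metric

variable [MetricSpace T]

/-- A reducing subspace that is orthogonal to `e` on the minimal sets is trivial. -/
lemma IsCuntz.eq_bot_of_reducing [CompleteSpace T] (hV : IsCuntz V) (he : Continuous e)
    (he1 : ∀ t, ‖e t‖ = 1) (hspan : (Submodule.span ℂ (Set.range e)).topologicalClosure = ⊤)
    (hVe : ∀ i t, adjoint (V i) (e t) = ν i t • e (g i t)) {k : NNReal} (hk : k < 1)
    (hg : ∀ i, LipschitzWith k (g i)) {L : Submodule ℂ K} [L.HasOrthogonalProjection]
    (h1 : ∀ i, ∀ x ∈ L, V i x ∈ L) (h2 : ∀ i, ∀ x ∈ L, adjoint (V i) x ∈ L)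
    (hmin : ∀ M : Set T, IsMinimalSet g ν M → ∀ s ∈ M, e s ∈ Lᗮ) : L = ⊥ := by
  set f : T → ℝ := fun t => ‖L.starProjection (e t)‖ ^ 2 with hf
  have hfc : Continuous f := by fun_prop
  have hharm : ∀ t, f t = ∑ i, ‖ν i t‖ ^ 2 * f (g i t) := fun t => by
    simp only [hf]
    rw [← hV.sum_norm_adjoint_sq]
    refine Finset.sum_congr rfl fun i _ => ?_
    rw [← starProjection_adjoint_apply (h1 i) (h2 i), hVe, map_smul, norm_smul, mul_pow]
  have hzero : ∀ t, L.starProjection (e t) = 0 := fun x => by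
    set X := closure (Set.range fun ω : List (Fin N) => wordMap g ω x)
    have hxX : x ∈ X := subset_closure ⟨[], rfl⟩
    obtain ⟨y, hyX, hy⟩ := (isCompact_closure_orbit hk hg x).exists_isMaxOn ⟨x, hxX⟩
      hfc.continuousOn
    -- Maximum principle: `f t` is a weighted mean of the values `f (g i t) ≤ f y`, so equality
    -- holds wherever the weight is nonzero.
    have hinv : IsInvariant g ν (X ∩ f ⁻¹' {f y}) := by
      rintro t ⟨htX, hty⟩ i hi
      have hX : ∀ j, g j t ∈ X := fun j => mapsTo_closure_orbit hg x j htX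
      refine ⟨hX i, le_antisymm (hy (hX i)) (not_lt.1 fun hlt => ?_)⟩
      have h3 : ∑ j, ‖ν j t‖ ^ 2 * f (g j t) < ∑ j, ‖ν j t‖ ^ 2 * f y :=
        Finset.sum_lt_sum (fun j _ => mul_le_mul_of_nonneg_left (hy (hX j)) (by positivity))
          ⟨i, Finset.mem_univ i, mul_lt_mul_of_pos_left hlt (by positivity)⟩
      rw [← hharm, ← Finset.sum_mul, hV.sum_norm_weight_sq hVe he1, one_mul] at h3
      exact h3.ne hty
    obtain ⟨M, hM, hMmin⟩ := exists_isMinimalSet_subset (A := X ∩ f ⁻¹' {f y}) ⟨y, hyX, rfl⟩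
      ((isCompact_closure_orbit hk hg x).inter_right (isClosed_singleton.preimage hfc)) hinv
    obtain ⟨s, hs⟩ := hMmin.1
    have hfs : f s = 0 := by
      simp [hf, L.starProjection_apply_eq_zero_iff.2 (hmin M hMmin s hs)]
    have hfx : f x ≤ 0 := by
      rw [← hfs, show f s = f y from (hM hs).2]
      exact hy hxX
    have hfx' : ‖L.starProjection (e x)‖ ^ 2 = 0 := le_antisymm hfx (by positivity)
    simpa using hfx'
  refine (Submodule.eq_bot_iff _).2 fun v hv => ?_
  have hle : (Submodule.span ℂ (Set.range e)).topologicalClosure ≤ (ℂ ∙ v)ᗮ := by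
    refine Submodule.topologicalClosure_minimal _ (Submodule.span_le.2 ?_)
      (Submodule.isClosed_orthogonal _)
    rintro _ ⟨t, rfl⟩
    exact Submodule.mem_orthogonal_singleton_iff_inner_right.2
      ((Submodule.mem_orthogonal _ _).1 (L.starProjection_apply_eq_zero_iff.1 (hzero t))
        v hv)
  rw [hspan] at hle
  exact inner_self_eq_zero.1
    (Submodule.mem_orthogonal_singleton_iff_inner_right.1 (hle (Submodule.mem_top (x := v))))

variable {k : NNReal}

/-- On the union of the minimal sets a walk that is reversing there moves along cycles; one
function describes it. -/
lemma exists_step (hV : IsCuntz V) (he : Continuous e) (he1 : ∀ t, ‖e t‖ = 1)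
    (hVe : ∀ i t, adjoint (V i) (e t) = ν i t • e (g i t)) (hk : k < 1)
    (hg : ∀ i, LipschitzWith k (g i))
    (hrev : ∀ M : Set T, IsMinimalSet g ν M → IsReversingOn V e g ν M) :
    ∃ F : T → T,
      (∀ n t, ∃ ω : List (Fin N), ω.length = n ∧ wordMap g ω t = F^[n] t ∧
        wordWeight g ν ω t ≠ 0) ∧
      (∀ M, IsMinimalSet g ν M → ∀ t ∈ M, (∃ p, 0 < p ∧ Function.IsPeriodicPt F p t) ∧
        M = Set.range fun n => F^[n] t) ∧
      ∀ M M' : Set T, IsMinimalSet g ν M → IsMinimalSet g ν M' → ∀ t ∈ M, ∀ s ∈ M',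
        ⟪e t, e s⟫ ≠ 0 → t = s := by
  -- Off the minimal sets this choice is arbitrary; on them it is the only possible digit.
  choose a ha using hV.exists_weight_ne_zero hVe he1
  set F : T → T := fun t => g (a t) t with hFdef
  set U : Set T := ⋃₀ {M | IsMinimalSet g ν M} with hU
  have ha' : ∀ t ∈ U, ∀ l, ν l t ≠ 0 → l = a t := by
    rintro t ⟨M, hM, ht⟩ l hl
    exact (hrev M hM).eq_of_weight_ne_zero hV hVe he1 ht hl (ha t)
  have hFM : ∀ M, IsInvariant g ν M → Set.MapsTo F M M := fun M hM t ht => hM t ht _ (ha t)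
  have hFU : Set.MapsTo F U U := by
    rintro t ⟨M, hM, ht⟩
    exact ⟨M, hM, hFM M hM.2.2.1 ht⟩
  have hF : ∀ t ∈ U, ∀ s ∈ U, ⟪e t, e s⟫ ≠ 0 →
      ⟪e (F t), e (F s)⟫ ≠ 0 ∧ dist (F t) (F s) ≤ k * dist t s := fun t ht s hs h => by
    obtain ⟨h1, h2⟩ := hV.inner_step hVe (ha' t ht) (ha' s hs) h
    refine ⟨h2, ?_⟩
    simp only [hFdef]
    rw [h1]
    exact (hg _).dist_le_mul _ _
  have hMU : ∀ M, IsMinimalSet g ν M → M ⊆ U := fun M hM => Set.subset_sUnion_of_mem hM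
  have horbit : ∀ M, IsMinimalSet g ν M → ∀ z ∈ M, ∀ p, 0 < p → Function.IsPeriodicPt F p z →
      M = Set.range fun n => F^[n] z := fun M hM z hz p hp hpz => by
    have hsub : (Set.range fun n => F^[n] z) ⊆ M := by
      rintro _ ⟨n, rfl⟩
      exact (hFM M hM.2.2.1).iterate n hz
    -- A periodic orbit is finite, hence compact, and invariant since `F` is the only transition;
    -- minimality makes it all of `M`.
    refine (hM.2.2.2 _ hsub ⟨z, 0, rfl⟩ (Set.Finite.isCompact ?_) ?_).symm
    · refine ((Set.finite_lt_nat p).image fun n => F^[n] z).subset ?_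
      rintro _ ⟨n, rfl⟩
      exact ⟨n % p, Nat.mod_lt _ hp, hpz.iterate_mod_apply n⟩
    · rintro _ ⟨n, rfl⟩ i hi
      refine ⟨n + 1, ?_⟩
      simp only [Function.iterate_succ_apply']
      rw [ha' _ (hMU M hM (hsub ⟨n, rfl⟩)) i hi]
  have hper : ∀ M, IsMinimalSet g ν M → ∀ t ∈ M,
      ∃ p, 0 < p ∧ Function.IsPeriodicPt F p t := fun M hM t ht => by
    obtain ⟨z, hz, p, hp, hpz⟩ := exists_isPeriodicPt he he1 hk hM.2.1 hM.1
      (hFM M hM.2.2.1) fun t ht s hs => hF t (hMU M hM ht) s (hMU M hM hs)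
    rw [horbit M hM z hz p hp hpz] at ht
    obtain ⟨n, rfl⟩ := ht
    exact ⟨p, hp, hpz.apply_iterate n⟩
  refine ⟨F, exists_word_iterate ha, fun M hM t ht => ⟨hper M hM t ht, ?_⟩,
    fun M M' hM hM' t ht s hs h => ?_⟩
  · obtain ⟨p, hp, hpt⟩ := hper M hM t ht
    exact horbit M hM t ht p hp hpt
  · obtain ⟨p, hp, hpt⟩ := hper M hM t ht
    obtain ⟨q, hq, hqs⟩ := hper M' hM' s hs
    exact eq_of_inner_ne_zero hk hFU hF (hMU M hM ht) (hMU M' hM' hs) h hp hq hpt hqs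

end Metric

end Operators

end CuntzWalk

/-! ### Finiteness and the orthonormal basis. -/

open CuntzWalk

theorem corollary3p23 {K : Type*} [NormedAddCommGroup K] [InnerProductSpace ℂ K]
    [CompleteSpace K] {T : Type*} [MetricSpace T] [CompleteSpace T]
    {N : ℕ} (hN : 2 ≤ N) (V : Fin N → K →L[ℂ] K) (hV : CuntzWalk.IsCuntz V)
    (e : T → K) (he : Continuous e) (he1 : ∀ t, ‖e t‖ = 1)
    (hspan : (Submodule.span ℂ (Set.range e)).topologicalClosure = ⊤)
    (g : Fin N → T → T) (ν : Fin N → T → ℂ)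
    (hVe : ∀ i t, ContinuousLinearMap.adjoint (V i) (e t) = ν i t • e (g i t))
    (hg : ∀ i, ∃ k : NNReal, ContractingWith k (g i))
    (hrev : ∀ M : Set T, CuntzWalk.IsMinimalSet g ν M → CuntzWalk.IsReversingOn V e g ν M) :
    {M : Set T | CuntzWalk.IsMinimalSet g ν M}.Finite ∧
    (∀ M : Set T, CuntzWalk.IsMinimalSet g ν M → ∀ c ∈ M, ∀ j, ‖ν j c‖ = 0 ∨ ‖ν j c‖ = 1) ∧
    ∀ c : {M : Set T // CuntzWalk.IsMinimalSet g ν M} → T, (∀ M, c M ∈ M.1) →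
      ∃ b : HilbertBasis
          (Σ M : {M : Set T // CuntzWalk.IsMinimalSet g ν M}, CuntzWalk.noCycleEnd g ν (c M)) ℂ K,
        ∀ x, b x = CuntzWalk.wordOp V x.2.1 (e (c x.1)) := by
  obtain ⟨k, hk, hgk⟩ : ∃ k : NNReal, k < 1 ∧ ∀ i, LipschitzWith k (g i) := by
    choose κ hκ using hg
    exact ⟨Finset.univ.sup κ, (Finset.sup_lt_iff (by simp)).2 fun i _ => (hκ i).1,
      fun i => (hκ i).2.weaken (Finset.le_sup (Finset.mem_univ i))⟩
  obtain ⟨F, hword, hcyc, horth⟩ := exists_step hV he he1 hVe hk hgk hrev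
  have heq : ∀ M M' : Set T, IsMinimalSet g ν M → IsMinimalSet g ν M' → ∀ t ∈ M, t ∈ M' →
      M = M' := fun M M' hM hM' t ht ht' =>
    ((hcyc M hM t ht).2).trans ((hcyc M' hM' t ht').2).symm
  refine ⟨?_, fun M hM t ht j => ?_, fun c hc => ?_⟩
  · have hfin : (⋃₀ {M | IsMinimalSet g ν M}).Finite := by
      by_contra hinf
      obtain ⟨x0⟩ : Nonempty T := ⟨(Set.Infinite.nonempty hinf).choose⟩
      set x := Set.Infinite.natEmbedding _ hinf
      obtain ⟨m, n, hmn, h⟩ := exists_lt_inner_ne_zero he he1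
        (isCompact_closure_orbit hk hgk x0) (fun n => (x n : T)) fun n => by
          obtain ⟨M, hM, ht⟩ := (x n).2
          obtain ⟨p, hp, hpt⟩ := (hcyc M hM _ ht).1
          -- Going round a cycle `j` times gives arbitrarily long words fixing the point.
          refine mem_closure_orbit hk hgk x0 _ fun j => ?_
          obtain ⟨ω, h1, h2, -⟩ := hword (p * j) (x n)
          exact ⟨ω, by rw [h1]; exact Nat.le_mul_of_pos_left j hp,
            h2.trans (hpt.mul_const j).eq⟩
      obtain ⟨M, hM, ht⟩ := (x m).2
      obtain ⟨M', hM', ht'⟩ := (x n).2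
      exact hmn.ne (x.injective (Subtype.ext (horth M M' hM hM' _ ht _ ht' h)))
    exact hfin.finite_subsets.subset fun M hM => Set.subset_sUnion_of_mem hM
  · by_cases h : ν j t = 0
    · exact .inl (by simp [h])
    · exact .inr ((hrev M hM).norm_weight hV he1 ht h)
  · set v : (Σ M : {M : Set T // IsMinimalSet g ν M}, noCycleEnd g ν (c M)) → K :=
      fun x => wordOp V x.2.1 (e (c x.1)) with hv
    -- A nonzero inner product makes `α` lead from `c M` to a point nonorthogonal to `c M'`, hence
    -- equal to it; so `M = M'` and `α` is a loop.
    have key : ∀ (M M' : {M : Set T // IsMinimalSet g ν M}) (α : List (Fin N)),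
        inner ℂ (e (c M)) (wordOp V α (e (c M'))) ≠ 0 → M = M' ∧
          (α ≠ [] → ∃ β, IsCycleWord g ν (c M) β ∧ β <:+ α) := fun M M' α h => by
      rw [inner_wordOp hVe] at h
      have hw : wordWeight g ν α (c M) ≠ 0 := by
        simpa using left_ne_zero_of_mul h
      have hmem := M.2.2.2.1.wordMap_mem (hc M) hw
      have hmap := horth M M' M.2 M'.2 _ hmem _ (hc M') (right_ne_zero_of_mul h)
      obtain rfl : M = M' :=
        Subtype.ext (heq M M' M.2 M'.2 _ hmem (hmap ▸ hc M'))
      exact ⟨rfl, fun hα => exists_isCycleWord_suffix α hα hmap hw⟩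
    have hon : Orthonormal ℂ v := by
      refine ⟨fun x => by simp [hv, hV.norm_wordOp, he1], ?_⟩
      rintro ⟨M, ω, hω⟩ ⟨M', τ, hτ⟩ hne
      by_contra h
      rcases hV.prefix_of_inner_ne_zero ω τ _ _ h with ⟨α, rfl, hα⟩ | ⟨α, rfl, hα⟩
      · obtain ⟨rfl, hcw⟩ := key M M' α hα
        by_cases h0 : α = []
        · subst h0; simp at hne
        · obtain ⟨β, hβ, hs⟩ := hcw h0
          exact hτ ⟨β, hβ, hs.trans (List.suffix_append _ _)⟩
      · rw [ne_eq, inner_eq_zero_symm] at hα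
        obtain ⟨rfl, hcw⟩ := key M' M α hα
        by_cases h0 : α = []
        · subst h0; simp at hne
        · obtain ⟨β, hβ, hs⟩ := hcw h0
          exact hω ⟨β, hβ, hs.trans (List.suffix_append _ _)⟩
    set W := Submodule.span ℂ (Set.range v) with hW
    -- Induction on length: a final cycle word only contributes a scalar.
    have hbase : ∀ (M : {M : Set T // IsMinimalSet g ν M}) (n : ℕ) (ω : List (Fin N)),
        ω.length = n → wordOp V ω (e (c M)) ∈ W := fun M n => by
      induction n using Nat.strong_induction_on with
      | _ n ih =>
        rintro ω rfl
        by_cases hω : ω ∈ noCycleEnd g ν (c M)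
        · exact Submodule.subset_span ⟨⟨M, ω, hω⟩, rfl⟩
        · obtain ⟨β, hβ, τ, rfl⟩ := not_not.1 hω
          have hloop := (hrev M M.2).wordOp_apply M.2.2.2.1 (hc M) hβ.2.2.1
          rw [hβ.2.1] at hloop
          rw [wordOp_append, hloop, map_smul]
          refine W.smul_mem _ (ih _ ?_ τ rfl)
          simpa using List.length_pos_of_ne_nil hβ.1
    -- A path `γ` runs along the cycle from `s` to `c`, so `V_γ e_c` is a nonzero multiple of `e s`,
    -- and `ω ++ γ` reduces the claim to `hbase`.
    have hmem : ∀ M, IsMinimalSet g ν M → ∀ s ∈ M, ∀ ω, wordOp V ω (e s) ∈ W :=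
      fun M hM s hs ω => by
        have hcs : c ⟨M, hM⟩ ∈ Set.range fun n => F^[n] s := (hcyc M hM s hs).2 ▸ hc ⟨M, hM⟩
        obtain ⟨n, hn⟩ := hcs
        obtain ⟨γ, -, hγ, hw⟩ := hword n s
        have hpath := (hrev M hM).wordOp_apply hM.2.2.1 hs hw
        rw [hγ, show F^[n] s = c ⟨M, hM⟩ from hn] at hpath
        have hw' : starRingEnd ℂ (wordWeight g ν γ s) ≠ 0 := by simpa using hw
        have h := hbase ⟨M, hM⟩ _ (ω ++ γ) rfl
        rw [wordOp_append, hpath, map_smul] at h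
        exact (W.smul_mem_iff hw').1 h
    have hWV : ∀ i, ∀ x ∈ W, V i x ∈ W := fun i x hx => by
      refine (Submodule.span_le (p := W.comap (V i).toLinearMap)).2 ?_ hx
      rintro _ ⟨⟨M, ω, hω⟩, rfl⟩
      have := hmem M M.2 _ (hc M) (i :: ω)
      rwa [wordOp_cons] at this
    have hWV' : ∀ i, ∀ x ∈ W, ContinuousLinearMap.adjoint (V i) x ∈ W := fun i x hx => by
      refine (Submodule.span_le
        (p := W.comap (ContinuousLinearMap.adjoint (V i)).toLinearMap)).2 ?_ hx
      rintro _ ⟨⟨M, ω, hω⟩, rfl⟩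
      change ContinuousLinearMap.adjoint (V i) (wordOp V ω (e (c M))) ∈ W
      cases ω with
      | nil =>
        change ContinuousLinearMap.adjoint (V i) (e (c M)) ∈ W
        rw [hVe]
        by_cases h : ν i (c M) = 0
        · simp [h]
        · exact W.smul_mem _ (hmem M M.2 _ (M.2.2.2.1 _ (hc M) i h) [])
      | cons j ω =>
        rw [wordOp_cons, hV.adjoint_apply]
        split_ifs
        · exact hmem M M.2 _ (hc M) ω
        · exact W.zero_mem
    have hbot : Wᗮ = ⊥ := by
      refine hV.eq_bot_of_reducing he he1 hspan hVe hk hgk (fun i x hx => ?_) (fun i x hx => ?_)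
        fun M hM s hs => W.le_orthogonal_orthogonal (hmem M hM s hs [])
      · refine (Submodule.mem_orthogonal _ _).2 fun u hu => ?_
        rw [← ContinuousLinearMap.adjoint_inner_left]
        exact (Submodule.mem_orthogonal _ _).1 hx _ (hWV' i u hu)
      · refine (Submodule.mem_orthogonal _ _).2 fun u hu => ?_
        rw [ContinuousLinearMap.adjoint_inner_right]
        exact (Submodule.mem_orthogonal _ _).1 hx _ (hWV i u hu)
    exact ⟨HilbertBasis.mkOfOrthogonalEqBot hon hbot, fun x => by
      rw [HilbertBasis.coe_mkOfOrthogonalEqBot]⟩
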